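/- Theorem (almost $P$ hidden $Z$ $\Rightarrow$ inverse is $N$ of second category). Call a real square matrix a $Z$-matrix if all its off-diagonal entries are nonpositive. A matrix $A\in\mathbb{R}^{n\times n}$ is a hidden $Z$-matrix if there exist $Z$-matrices $X,Y\in\mathbb{R}^{n\times n}$ and vectors $r,s\in\mathbb{R}^n$ with nonnegative components such that $AX=Y$ and every component of $r^TX+s^TY$ is positive. It is an almost $P$-matrix if all its principal minors of order at most $n-1$ are positive and $\det A<0$. A real square matrix is an $N$-matrix if all its (nonempty) principal minors are negative, and an $N$-matrix is of the second category if it contains no positive entry. Let $A\in\mathbb{R}^{n\times n}$ be a hidden $Z$-matrix. If $A$ is an almost $P$-matrix, then $A^{-1}$ is an $N$-matrix of the second category; that is, all principal minors of $A^{-1}$ are negative and $A^{-1}$ has no positive entry. -/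

import Mathlib

/-- A real square matrix is a `Z`-matrix if all its off-diagonal entries are nonpositive. -/
def IsZMatrix {n : ℕ} (A : Matrix (Fin n) (Fin n) ℝ) : Prop :=
  ∀ i j, i ≠ j → A i j ≤ 0

/-- `A` is a hidden `Z`-matrix if there are `Z`-matrices `X`, `Y` and nonnegative vectors `r`, `s`
with `A X = Y` and every component of the row vector `rᵀ X + sᵀ Y` positive. -/
def IsHiddenZMatrix {n : ℕ} (A : Matrix (Fin n) (Fin n) ℝ) : Prop :=
  ∃ (X Y : Matrix (Fin n) (Fin n) ℝ) (r s : Fin n → ℝ),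
    IsZMatrix X ∧ IsZMatrix Y ∧ (∀ i, 0 ≤ r i) ∧ (∀ i, 0 ≤ s i) ∧
      A * X = Y ∧ ∀ j, 0 < (Matrix.vecMul r X + Matrix.vecMul s Y) j

/-- The principal minor of `A` on the index set `α`: the determinant of the submatrix of `A`
formed by the rows and columns with index in `α`. -/
noncomputable def principalMinor {n : ℕ} (A : Matrix (Fin n) (Fin n) ℝ) (α : Finset (Fin n)) : ℝ :=
  (A.submatrix (fun i : α => (i : Fin n)) (fun i : α => (i : Fin n))).det

/-- `A` is an almost `P`-matrix if all its principal minors of order `1, …, n - 1` are positive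
and `det A < 0`. -/
def IsAlmostPMatrix {n : ℕ} (A : Matrix (Fin n) (Fin n) ℝ) : Prop :=
  (∀ α : Finset (Fin n), α.Nonempty → α.card < n → 0 < principalMinor A α) ∧ A.det < 0

/-- `A` is an `N`-matrix if all its principal minors are negative. -/
def IsNMatrix {n : ℕ} (A : Matrix (Fin n) (Fin n) ℝ) : Prop :=
  ∀ α : Finset (Fin n), α.Nonempty → principalMinor A α < 0

/-- An `N`-matrix is of the second category if it contains no positive entry. -/
def IsNMatrixSecondCategory {n : ℕ} (A : Matrix (Fin n) (Fin n) ℝ) : Prop :=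
  IsNMatrix A ∧ ¬ ∃ i j, 0 < A i j

open scoped Matrix

variable {n : ℕ}

/-! Negativity of the minors of `A⁻¹` is Jacobi's identity; the entries need the hidden `Z`
structure. Scaling the rows of `X` and `Y` by `r` and `s` and adding gives a `Z`-matrix with
positive column sums, an `M`-matrix. Its rows can be made pure rows of `X` or `Y` one at a time
(`exists_rowChoice_isMMatrix`). If all come from `Y`, comparing columns of `Y⁻¹` settles the signs
(`nonpos_of_isMMatrix`). Otherwise `det X > 0`, so every mixture other than `Y` itself is an
`M`-matrix, and two such mixtures force a column of `Y⁻¹` to vanish if `A⁻¹` has a positive entry.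
-/

/-- A nonsingular `M`-matrix: a `Z`-matrix with positive determinant and nonnegative inverse. -/
structure IsMMatrix (N : Matrix (Fin n) (Fin n) ℝ) : Prop where
  isZMatrix : IsZMatrix N
  det_pos : 0 < N.det
  monotone : ∀ u : Fin n → ℝ, (∀ i, 0 ≤ (N *ᵥ u) i) → ∀ i, 0 ≤ u i

/-- The matrix with the rows of `Y` on `β` and the rows of `X` elsewhere. -/
def rowChoice (β : Finset (Fin n)) (Y X : Matrix (Fin n) (Fin n) ℝ) :
    Matrix (Fin n) (Fin n) ℝ :=
  Matrix.of fun i j => if i ∈ β then Y i j else X i j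

/-- The matrix whose `i`-th row is `r i` times that of `X` plus `s i` times that of `Y`. -/
def rowCombination (r s : Fin n → ℝ) (X Y : Matrix (Fin n) (Fin n) ℝ) :
    Matrix (Fin n) (Fin n) ℝ :=
  Matrix.of fun i j => r i * X i j + s i * Y i j

theorem single_one_nonneg (i k : Fin n) : 0 ≤ (Pi.single i 1 : Fin n → ℝ) k := by
  by_cases h : k = i <;> simp [h]

theorem rowChoice_mul (β : Finset (Fin n)) (Y X M : Matrix (Fin n) (Fin n) ℝ) :
    rowChoice β Y X * M = rowChoice β (Y * M) (X * M) := by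
  ext i j
  by_cases h : i ∈ β <;> simp [rowChoice, Matrix.mul_apply, h]

theorem rowChoice_mulVec (β : Finset (Fin n)) (Y X : Matrix (Fin n) (Fin n) ℝ) (v : Fin n → ℝ)
    (i : Fin n) :
    (rowChoice β Y X *ᵥ v) i = if i ∈ β then (Y *ᵥ v) i else (X *ᵥ v) i := by
  by_cases h : i ∈ β <;> simp [rowChoice, Matrix.mulVec, dotProduct, h]

theorem rowChoice_univ (Y X : Matrix (Fin n) (Fin n) ℝ) : rowChoice Finset.univ Y X = Y := by
  ext i j
  simp [rowChoice]

theorem isZMatrix_rowCombination {X Y : Matrix (Fin n) (Fin n) ℝ} (hX : IsZMatrix X)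
    (hY : IsZMatrix Y) {r s : Fin n → ℝ} (hr : ∀ i, 0 ≤ r i) (hs : ∀ i, 0 ≤ s i) :
    IsZMatrix (rowCombination r s X Y) := by
  intro i j hij
  have h1 := mul_nonpos_of_nonneg_of_nonpos (hr i) (hX i j hij)
  have h2 := mul_nonpos_of_nonneg_of_nonpos (hs i) (hY i j hij)
  simp only [rowCombination, Matrix.of_apply]
  linarith

/-! ### Principal minors of the inverse -/

theorem det_rowChoice_one (A : Matrix (Fin n) (Fin n) ℝ) (β : Finset (Fin n)) :
    (rowChoice β A 1).det = principalMinor A β := by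
  rw [Matrix.twoBlockTriangular_det (rowChoice β A 1) (fun i => i ∈ β)]
  · have h1 : Matrix.toSquareBlockProp (rowChoice β A 1) (fun i => i ∈ β)
        = A.submatrix (fun i : β => (i : Fin n)) (fun i : β => (i : Fin n)) := by
      ext i j
      simp [Matrix.toSquareBlockProp, rowChoice]
    have h2 : Matrix.toSquareBlockProp (rowChoice β A 1) (fun i => ¬ i ∈ β) = 1 := by
      ext i j
      simp [Matrix.toSquareBlockProp, rowChoice, i.2, Matrix.one_apply, Subtype.ext_iff]
    rw [h2, Matrix.det_one, mul_one, h1, principalMinor]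
    congr!
  · intro i hi j hj
    have hij : i ≠ j := fun h => hi (h ▸ hj)
    simp [rowChoice, hi, hij]

/-- Jacobi's identity for complementary principal minors. -/
theorem principalMinor_inv {A : Matrix (Fin n) (Fin n) ℝ} (hA : A.det ≠ 0)
    (α : Finset (Fin n)) : principalMinor A⁻¹ α = principalMinor A αᶜ * A.det⁻¹ := by
  have hu : IsUnit A.det := hA.isUnit
  -- Both determinants become principal minors, since the rows taken from `1` make the matrices
  -- block triangular.
  have h : rowChoice α A⁻¹ 1 = rowChoice αᶜ A 1 * A⁻¹ := by
    rw [rowChoice_mul, Matrix.mul_nonsing_inv A hu, Matrix.one_mul]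
    ext i j
    by_cases hi : i ∈ α <;> simp [rowChoice, hi]
  rw [← det_rowChoice_one, h, Matrix.det_mul, det_rowChoice_one, Matrix.det_nonsing_inv,
    Ring.inverse_eq_inv']

theorem IsAlmostPMatrix.principalMinor_pos {A : Matrix (Fin n) (Fin n) ℝ}
    (hA : IsAlmostPMatrix A) {β : Finset (Fin n)} (hβ : β ≠ Finset.univ) :
    0 < principalMinor A β := by
  rcases β.eq_empty_or_nonempty with rfl | hne
  · simp [principalMinor]
  · refine hA.1 β hne ?_
    simpa using Finset.card_lt_univ_of_notMem
      (Classical.choose_spec (not_forall.1 fun h => hβ (Finset.eq_univ_iff_forall.2 h)))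

theorem IsAlmostPMatrix.isNMatrix_inv {A : Matrix (Fin n) (Fin n) ℝ} (hA : IsAlmostPMatrix A) :
    IsNMatrix A⁻¹ := by
  intro α hα
  rw [principalMinor_inv hA.2.ne]
  refine mul_neg_of_pos_of_neg (hA.principalMinor_pos fun h => ?_) (inv_lt_zero.2 hA.2)
  rw [Finset.compl_eq_univ_iff] at h
  exact hα.ne_empty h

theorem IsNMatrix.diag_neg {B : Matrix (Fin n) (Fin n) ℝ} (hB : IsNMatrix B) (i : Fin n) :
    B i i < 0 := by
  have h := hB {i} (Finset.singleton_nonempty i)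
  have : Unique ({i} : Finset (Fin n)) := ⟨⟨⟨i, by simp⟩⟩, fun x => Subtype.ext (Finset.mem_singleton.1 x.2)⟩
  rw [principalMinor, Matrix.det_unique] at h
  have hd : ((default : ({i} : Finset (Fin n))) : Fin n) = i :=
    Finset.mem_singleton.1 (default : ({i} : Finset (Fin n))).2
  simpa [hd] using h

/-! ### `M`-matrices -/

/-- Where `d k < 0`, adding `N d` leaves `N` applied to the positive part of `d`, which vanishes at
`k`; elsewhere the negative part itself vanishes at `k`. Only off-diagonal entries then contribute.
-/
theorem IsZMatrix.mulVec_negPart_nonpos {N : Matrix (Fin n) (Fin n) ℝ} (hN : IsZMatrix N)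
    {d : Fin n → ℝ} (hd : ∀ k, d k < 0 → 0 ≤ (N *ᵥ d) k) (k : Fin n) :
    (N *ᵥ fun l => max (-d l) 0) k ≤ 0 := by
  rcases lt_or_ge (d k) 0 with hk | hk
  · have h : (N *ᵥ fun l => max (-d l) 0) k + (N *ᵥ d) k ≤ 0 := by
      simp only [Matrix.mulVec, dotProduct, ← Finset.sum_add_distrib, ← mul_add]
      refine Finset.sum_nonpos fun l _ => ?_
      rcases eq_or_ne k l with rfl | hkl
      · rw [max_eq_left (by linarith)]
        simp
      · exact mul_nonpos_of_nonpos_of_nonneg (hN k l hkl) (by linarith [le_max_left (-d l) 0])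
    linarith [hd k hk]
  · simp only [Matrix.mulVec, dotProduct]
    refine Finset.sum_nonpos fun l _ => ?_
    rcases eq_or_ne k l with rfl | hkl
    · simp [max_eq_right (neg_nonpos.2 hk)]
    · exact mul_nonpos_of_nonpos_of_nonneg (hN k l hkl) (le_max_right _ _)

theorem IsMMatrix.nonneg_of_apply_eq_zero {N : Matrix (Fin n) (Fin n) ℝ} (hN : IsMMatrix N)
    {d : Fin n → ℝ} {i : Fin n} (hi : d i = 0) (hd : ∀ k, k ≠ i → 0 ≤ (N *ᵥ d) k) (k : Fin n) :
    0 ≤ d k := by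
  have h := hN.isZMatrix.mulVec_negPart_nonpos (d := d) fun k hk =>
    hd k fun h => by rw [h, hi] at hk; exact lt_irrefl _ hk
  have h2 := hN.monotone (-fun l => max (-d l) 0)
    (fun l => by rw [Matrix.mulVec_neg]; simpa using h l) k
  have h3 := le_max_left (-d k) 0
  simp only [Pi.neg_apply] at h2
  linarith

theorem IsZMatrix.monotone_of_colSum_pos {N : Matrix (Fin n) (Fin n) ℝ} (hN : IsZMatrix N)
    (hc : ∀ j, 0 < ∑ i, N i j) {u : Fin n → ℝ} (hu : ∀ i, 0 ≤ (N *ᵥ u) i) (i : Fin n) :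
    0 ≤ u i := by
  have h : ∑ k, (N *ᵥ fun l => max (-u l) 0) k ≤ 0 :=
    Finset.sum_nonpos fun k _ => hN.mulVec_negPart_nonpos (fun k _ => hu k) k
  simp only [Matrix.mulVec, dotProduct] at h
  rw [Finset.sum_comm] at h
  simp only [← Finset.sum_mul] at h
  have h0 : ∀ l ∈ Finset.univ, 0 ≤ (∑ k, N k l) * max (-u l) 0 :=
    fun l _ => mul_nonneg (hc l).le (le_max_right _ _)
  have h1 := (Finset.sum_eq_zero_iff_of_nonneg h0).1 (le_antisymm h (Finset.sum_nonneg h0)) i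
    (Finset.mem_univ i)
  have h2 := (mul_eq_zero.1 h1).resolve_left (hc i).ne'
  linarith [le_max_left (-u i) 0]

theorem det_ne_zero_of_monotone {N : Matrix (Fin n) (Fin n) ℝ}
    (hN : ∀ u : Fin n → ℝ, (∀ i, 0 ≤ (N *ᵥ u) i) → ∀ i, 0 ≤ u i) : N.det ≠ 0 := by
  intro h
  obtain ⟨v, hv, hNv⟩ := Matrix.exists_mulVec_eq_zero_iff.2 h
  refine hv (funext fun i => le_antisymm ?_ ?_)
  · simpa using hN (-v) (fun i => by simp [Matrix.mulVec_neg, hNv]) i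
  · exact hN v (fun i => by simp [hNv]) i

theorem IsZMatrix.isMMatrix_of_colSum_pos {N : Matrix (Fin n) (Fin n) ℝ} (hN : IsZMatrix N)
    (hc : ∀ j, 0 < ∑ i, N i j) : IsMMatrix N := by
  refine ⟨hN, ?_, fun u hu => hN.monotone_of_colSum_pos hc hu⟩
  -- Along the segment from the identity to `N`, the `Z` sign pattern and positive column sums
  -- persist, so the determinant never vanishes and keeps its sign.
  let f : ℝ → ℝ := fun t => ((1 - t) • (1 : Matrix (Fin n) (Fin n) ℝ) + t • N).det
  have hf : Continuous f := by
    refine Continuous.matrix_det ?_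
    fun_prop
  have hne : ∀ t ∈ Set.Icc (0 : ℝ) 1, f t ≠ 0 := by
    rintro t ⟨ht0, ht1⟩
    refine det_ne_zero_of_monotone fun u hu => IsZMatrix.monotone_of_colSum_pos ?_ ?_ hu
    · intro i j hij
      simpa [Matrix.one_apply, hij] using mul_nonpos_of_nonneg_of_nonpos ht0 (hN i j hij)
    · intro j
      have h : ∑ i, ((1 - t) • (1 : Matrix (Fin n) (Fin n) ℝ) + t • N) i j
          = (1 - t) + t * ∑ i, N i j := by
        simp [Matrix.one_apply, Finset.sum_add_distrib, Finset.mul_sum]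
      rw [h]
      rcases ht0.eq_or_lt with rfl | ht
      · simp
      · have := mul_pos ht (hc j)
        linarith
  by_contra! hneg
  have h0 : f 0 = 1 := by simp [f]
  have h1 : f 1 = N.det := by simp [f]
  obtain ⟨t, ht, hft⟩ := intermediate_value_Icc' (zero_le_one' ℝ) hf.continuousOn
    (show (0 : ℝ) ∈ Set.Icc (f 1) (f 0) by rw [h0, h1]; exact ⟨hneg, zero_le_one⟩)
  exact hne t ht hft

theorem IsMMatrix.mulVec_inv_mulVec {N : Matrix (Fin n) (Fin n) ℝ} (hN : IsMMatrix N)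
    (b : Fin n → ℝ) : N *ᵥ (N⁻¹ *ᵥ b) = b := by
  rw [Matrix.mulVec_mulVec, Matrix.mul_nonsing_inv N hN.det_pos.ne'.isUnit, Matrix.one_mulVec]

/-- Cofactor expansion along row `i`: `h` is column `i` of the inverse, so `N.det • h` lists the
cofactors. -/
theorem det_updateRow_eq_mul_dotProduct {N : Matrix (Fin n) (Fin n) ℝ} {h : Fin n → ℝ}
    {i : Fin n} (hh : N *ᵥ h = Pi.single i 1) (x : Fin n → ℝ) :
    (N.updateRow i x).det = N.det * (x ⬝ᵥ h) := by
  have h1 : N.det • h = N.adjugate *ᵥ Pi.single i 1 := by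
    rw [← hh, Matrix.mulVec_mulVec, Matrix.adjugate_mul, Matrix.smul_mulVec, Matrix.one_mulVec]
  rw [← smul_eq_mul, ← dotProduct_smul, h1, ← Matrix.cramer_transpose_apply,
    Matrix.cramer_eq_adjugate_mulVec, ← Matrix.adjugate_transpose]
  rw [Matrix.mulVec_single_one]
  simp [Matrix.mulVec, dotProduct, mul_comm]

theorem IsMMatrix.apply_pos_of_mulVec_eq_single {N : Matrix (Fin n) (Fin n) ℝ}
    (hN : IsMMatrix N) {h : Fin n → ℝ} {i : Fin n} (hh : N *ᵥ h = Pi.single i 1) : 0 < h i := by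
  have h0 : ∀ k, 0 ≤ h k := hN.monotone h fun k => by
    rw [hh]; exact single_one_nonneg _ k
  refine lt_of_le_of_ne (h0 i) fun hi => ?_
  have h1 : (N *ᵥ h) i ≤ 0 := by
    simp only [Matrix.mulVec, dotProduct]
    refine Finset.sum_nonpos fun k _ => ?_
    rcases eq_or_ne i k with rfl | hik
    · simp [← hi]
    · exact mul_nonpos_of_nonpos_of_nonneg (hN.isZMatrix i k hik) (h0 k)
  rw [hh, Pi.single_eq_same] at h1
  linarith

theorem dotProduct_nonpos_of_apply_eq_zero {x d : Fin n → ℝ} {i : Fin n}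
    (hx : ∀ k, i ≠ k → x k ≤ 0) (hd : ∀ k, 0 ≤ d k) (hi : d i = 0) : x ⬝ᵥ d ≤ 0 := by
  refine Finset.sum_nonpos fun k _ => ?_
  rcases eq_or_ne i k with rfl | hik
  · simp [hi]
  · exact mul_nonpos_of_nonpos_of_nonneg (hx k hik) (hd k)

/-- Eliminating the `i`-th coordinate of `g` by the `i`-th column of the inverse keeps `g`
nonnegative. -/
theorem IsMMatrix.sub_smul_nonneg {N : Matrix (Fin n) (Fin n) ℝ} (hN : IsMMatrix N)
    {g h : Fin n → ℝ} {i : Fin n} (hh : N *ᵥ h = Pi.single i 1)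
    (hg : ∀ k, k ≠ i → 0 ≤ (N *ᵥ g) k) :
    (g - (g i / h i) • h) i = 0 ∧ ∀ k, 0 ≤ (g - (g i / h i) • h) k := by
  have hi : (g - (g i / h i) • h) i = 0 := by
    simp [div_mul_cancel₀ _ (hN.apply_pos_of_mulVec_eq_single hh).ne']
  refine ⟨hi, hN.nonneg_of_apply_eq_zero hi fun k hk => ?_⟩
  rw [Matrix.mulVec_sub, Matrix.mulVec_smul, hh]
  simpa [hk] using hg k hk

/-- Replacing one row of an `M`-matrix gives an `M`-matrix as soon as the result is a `Z`-matrix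
with positive determinant. -/
theorem IsMMatrix.updateRow {N : Matrix (Fin n) (Fin n) ℝ} (hN : IsMMatrix N) {i : Fin n}
    {x : Fin n → ℝ} (hx : ∀ k, i ≠ k → x k ≤ 0) (hdet : 0 < (N.updateRow i x).det) :
    IsMMatrix (N.updateRow i x) := by
  refine ⟨?_, hdet, fun u hu => ?_⟩
  · intro k l hkl
    rcases eq_or_ne k i with rfl | hk
    · simpa using hx l hkl
    · simpa [hk] using hN.isZMatrix k l hkl
  have hh := hN.mulVec_inv_mulVec (Pi.single i 1)
  set h := N⁻¹ *ᵥ Pi.single i 1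
  have hi := hN.apply_pos_of_mulVec_eq_single hh
  have h0 : ∀ k, 0 ≤ h k := hN.monotone h fun k => by
    rw [hh]; exact single_one_nonneg _ k
  rw [det_updateRow_eq_mul_dotProduct hh] at hdet
  have hxh : 0 < x ⬝ᵥ h := pos_of_mul_pos_right hdet hN.det_pos.le
  rw [Matrix.updateRow_mulVec] at hu
  obtain ⟨hd0, hd⟩ := hN.sub_smul_nonneg (g := u) hh fun k hk => by simpa [hk] using hu k
  have hxu : 0 ≤ x ⬝ᵥ u := by simpa using hu i
  have hxd := dotProduct_nonpos_of_apply_eq_zero hx hd hd0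
  rw [dotProduct_sub, dotProduct_smul, smul_eq_mul] at hxd
  -- `u` is a nonnegative vector plus this multiple of `h`; a negative multiple would make `x ⬝ᵥ u`
  -- negative.
  have ht : 0 ≤ u i / h i := by
    by_contra! ht
    have := mul_neg_of_neg_of_pos ht hxh
    linarith
  intro k
  have h1 := hd k
  have h2 := mul_nonneg ht (h0 k)
  simp only [Pi.sub_apply, Pi.smul_apply, smul_eq_mul] at h1
  linarith

/-! ### Mixing rows of `X` and `Y` -/

theorem rowCombination_update (r s : Fin n → ℝ) (X Y : Matrix (Fin n) (Fin n) ℝ) (i : Fin n)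
    (a b : ℝ) :
    rowCombination (Function.update r i a) (Function.update s i b) X Y
      = (rowCombination r s X Y).updateRow i (a • X i + b • Y i) := by
  ext k l
  rcases eq_or_ne k i with rfl | hk
  · simp [rowCombination]
  · simp [rowCombination, hk]

/-- The determinant is linear in row `i` with nonnegative weights, so one of the two pure choices
has positive determinant. -/
theorem exists_pure_row_isMMatrix {X Y : Matrix (Fin n) (Fin n) ℝ} (hX : IsZMatrix X)
    (hY : IsZMatrix Y) {r s : Fin n → ℝ} (hr : ∀ i, 0 ≤ r i) (hs : ∀ i, 0 ≤ s i)
    (hM : IsMMatrix (rowCombination r s X Y)) (i : Fin n) :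
    ∃ a b : ℝ, (a = 1 ∧ b = 0 ∨ a = 0 ∧ b = 1) ∧
      IsMMatrix (rowCombination (Function.update r i a) (Function.update s i b) X Y) := by
  have hdet := hM.det_pos
  have h : rowCombination r s X Y
      = (rowCombination r s X Y).updateRow i (r i • X i + s i • Y i) := by
    rw [← rowCombination_update]
    simp
  rw [h, Matrix.det_updateRow_add, Matrix.det_updateRow_smul, Matrix.det_updateRow_smul] at hdet
  rcases lt_or_ge 0 ((rowCombination r s X Y).updateRow i (X i)).det with hx | hx
  · refine ⟨1, 0, by simp, ?_⟩
    rw [rowCombination_update]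
    simpa using hM.updateRow (hX i) hx
  · refine ⟨0, 1, by simp, ?_⟩
    rw [rowCombination_update]
    have h1 := mul_nonpos_of_nonneg_of_nonpos (hr i) hx
    have hy := pos_of_mul_pos_right (show 0 < s i * _ by linarith) (hs i)
    simpa using hM.updateRow (hY i) hy

theorem exists_rowChoice_isMMatrix {X Y : Matrix (Fin n) (Fin n) ℝ} (hX : IsZMatrix X)
    (hY : IsZMatrix Y) {r s : Fin n → ℝ} (hr : ∀ i, 0 ≤ r i) (hs : ∀ i, 0 ≤ s i)
    (hM : IsMMatrix (rowCombination r s X Y)) :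
    ∃ α : Finset (Fin n), IsMMatrix (rowChoice α Y X) := by
  have key : ∀ γ : Finset (Fin n), ∃ r' s' : Fin n → ℝ, (∀ i, 0 ≤ r' i) ∧ (∀ i, 0 ≤ s' i) ∧
      (∀ i ∈ γ, r' i = 1 ∧ s' i = 0 ∨ r' i = 0 ∧ s' i = 1) ∧
      IsMMatrix (rowCombination r' s' X Y) := by
    intro γ
    induction γ using Finset.induction_on with
    | empty => exact ⟨r, s, hr, hs, by simp, hM⟩
    | insert i γ hi ih =>
      obtain ⟨r', s', hr', hs', hpure, hM'⟩ := ih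
      obtain ⟨a, b, hab, hM''⟩ := exists_pure_row_isMMatrix hX hY hr' hs' hM' i
      refine ⟨_, _, fun k => ?_, fun k => ?_, fun k hk => ?_, hM''⟩
      · rcases eq_or_ne k i with rfl | hki
        · rcases hab with ⟨rfl, rfl⟩ | ⟨rfl, rfl⟩ <;> simp
        · simpa [hki] using hr' k
      · rcases eq_or_ne k i with rfl | hki
        · rcases hab with ⟨rfl, rfl⟩ | ⟨rfl, rfl⟩ <;> simp
        · simpa [hki] using hs' k
      · rcases eq_or_ne k i with rfl | hki
        · simpa using hab
        · simpa [hki] using hpure k ((Finset.mem_insert.1 hk).resolve_left hki)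
  obtain ⟨r', s', -, -, hpure, hM'⟩ := key Finset.univ
  refine ⟨Finset.univ.filter fun i => s' i = 1, ?_⟩
  convert hM' using 1
  ext i j
  rcases hpure i (Finset.mem_univ i) with ⟨h1, h2⟩ | ⟨h1, h2⟩ <;>
    simp [rowChoice, rowCombination, h1, h2]

theorem rowChoice_insert (β : Finset (Fin n)) (Y X : Matrix (Fin n) (Fin n) ℝ) (i : Fin n) :
    rowChoice (insert i β) Y X = (rowChoice β Y X).updateRow i (Y i) := by
  ext k l
  rcases eq_or_ne k i with rfl | hk
  · simp [rowChoice]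
  · simp [rowChoice, hk]

theorem rowChoice_eq_updateRow_insert {β : Finset (Fin n)} {i : Fin n} (hi : i ∉ β)
    (Y X : Matrix (Fin n) (Fin n) ℝ) :
    rowChoice β Y X = (rowChoice (insert i β) Y X).updateRow i (X i) := by
  ext k l
  rcases eq_or_ne k i with rfl | hk
  · simp [rowChoice, hi]
  · simp [rowChoice, hk]

theorem isMMatrix_rowChoice_iff_empty {X Y : Matrix (Fin n) (Fin n) ℝ} (hX : IsZMatrix X)
    (hY : IsZMatrix Y)
    (hdet : ∀ β : Finset (Fin n), β ≠ Finset.univ → 0 < (rowChoice β Y X).det)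
    (β : Finset (Fin n)) (hβ : β ≠ Finset.univ) :
    IsMMatrix (rowChoice β Y X) ↔ IsMMatrix (rowChoice ∅ Y X) := by
  induction β using Finset.induction_on with
  | empty => rfl
  | insert i β hi ih =>
    have hβ' : β ≠ Finset.univ := fun h => hi (h ▸ Finset.mem_univ i)
    rw [← ih hβ']
    constructor
    · intro h
      have hd := hdet β hβ'
      rw [rowChoice_eq_updateRow_insert hi] at hd ⊢
      exact h.updateRow (hX i) hd
    · intro h
      have hd := hdet _ hβ
      rw [rowChoice_insert] at hd ⊢
      exact h.updateRow (hY i) hd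

/-! ### Signs of the entries of the inverse -/

theorem nonpos_of_isMMatrix_rowChoice {X Y B : Matrix (Fin n) (Fin n) ℝ} (hXY : X = B * Y)
    (hB : ∀ i, B i i < 0) (hY : Y.det ≠ 0)
    (hM : ∀ β : Finset (Fin n), β ≠ Finset.univ → IsMMatrix (rowChoice β Y X)) (i j : Fin n) :
    B i j ≤ 0 := by
  by_contra! hij
  have hYg : Y *ᵥ (Y⁻¹ *ᵥ Pi.single j 1) = Pi.single j 1 := by
    rw [Matrix.mulVec_mulVec, Matrix.mul_nonsing_inv Y hY.isUnit, Matrix.one_mulVec]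
  set g := Y⁻¹ *ᵥ Pi.single j 1
  have hXg : ∀ k, (X *ᵥ g) k = B k j := fun k => by
    rw [hXY, ← Matrix.mulVec_mulVec, hYg]
    simp
  have h1 : ∀ k, 0 ≤ (-g) k := by
    -- This mixture sends `-g` to `-B j j` in row `j` and to zero elsewhere.
    refine (hM {j}ᶜ fun h => by simp at h).monotone _ fun k => ?_
    rw [Matrix.mulVec_neg, Pi.neg_apply, rowChoice_mulVec, hYg, hXg]
    rcases eq_or_ne k j with rfl | hk
    · simpa using (hB k).le
    · simp [hk]
  have h2 : ∀ k, 0 ≤ g k := by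
    -- Rows come from `X` exactly where `X g`, column `j` of `B`, is positive; row `i` keeps the
    -- mixture from being all of `Y`.
    refine (hM (Finset.univ.filter fun k => ¬ 0 < B k j) fun h => ?_).monotone _ fun k => ?_
    · have := h ▸ Finset.mem_univ i
      simp only [Finset.mem_filter] at this
      exact this.2 hij
    · rw [rowChoice_mulVec, hYg, hXg]
      by_cases hk : 0 < B k j
      · simpa [not_le.2 hk] using hk.le
      · simpa [not_lt.1 hk] using single_one_nonneg j k
  have hg : g = 0 := funext fun k => le_antisymm (by simpa using h1 k) (h2 k)
  have := congrFun hYg j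
  simp [hg] at this

theorem nonpos_of_isMMatrix {X Y B : Matrix (Fin n) (Fin n) ℝ} (hXY : X = B * Y)
    (hB : ∀ i, B i i < 0) (hX : IsZMatrix X) (hY : IsMMatrix Y) (i j : Fin n) :
    B i j ≤ 0 := by
  have hXg : ∀ l, X i ⬝ᵥ (Y⁻¹ *ᵥ Pi.single l 1) = B i l := fun l => by
    change (X *ᵥ (Y⁻¹ *ᵥ Pi.single l 1)) i = B i l
    rw [hXY, ← Matrix.mulVec_mulVec, hY.mulVec_inv_mulVec]
    simp
  have hh := hY.mulVec_inv_mulVec (Pi.single i 1)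
  have hg := hY.mulVec_inv_mulVec (Pi.single j 1)
  have hxh := hXg i
  have hxg := hXg j
  set h := Y⁻¹ *ᵥ Pi.single i 1
  set g := Y⁻¹ *ᵥ Pi.single j 1
  have hg0 : ∀ k, 0 ≤ (Y *ᵥ g) k := fun k => by
    rw [hg]; exact single_one_nonneg _ k
  obtain ⟨hd0, hd⟩ := hY.sub_smul_nonneg (g := g) hh fun k _ => hg0 k
  -- This reads `B i j ≤ (g i / h i) * B i i`.
  have hxd := dotProduct_nonpos_of_apply_eq_zero (hX i) hd hd0
  rw [dotProduct_sub, dotProduct_smul, smul_eq_mul, hxh, hxg] at hxd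
  have ht : 0 ≤ g i / h i :=
    div_nonneg (hY.monotone g hg0 i) (hY.apply_pos_of_mulVec_eq_single hh).le
  have := mul_nonpos_of_nonneg_of_nonpos ht (hB i).le
  linarith

theorem mainTheorem5 (n : ℕ) (A : Matrix (Fin n) (Fin n) ℝ)
    (hZ : IsHiddenZMatrix A) (hP : IsAlmostPMatrix A) :
    IsNMatrixSecondCategory A⁻¹ := by
  refine ⟨hP.isNMatrix_inv, ?_⟩
  obtain ⟨X, Y, r, s, hX, hY, hr, hs, hAX, hpos⟩ := hZ
  have hB := hP.isNMatrix_inv.diag_neg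
  have hXY : X = A⁻¹ * Y := by
    rw [← hAX, ← Matrix.mul_assoc, Matrix.nonsing_inv_mul A hP.2.ne.isUnit, Matrix.one_mul]
  obtain ⟨α, hα⟩ := exists_rowChoice_isMMatrix hX hY hr hs
    ((isZMatrix_rowCombination hX hY hr hs).isMMatrix_of_colSum_pos fun j => by
      simpa [rowCombination, Matrix.vecMul, dotProduct, Finset.sum_add_distrib] using hpos j)
  rintro ⟨i, j, hij⟩
  refine absurd hij (not_lt.2 ?_)
  by_cases hαu : α = Finset.univ
  · rw [hαu, rowChoice_univ] at hα
    exact nonpos_of_isMMatrix hXY hB hX hα i j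
  · have hdet : ∀ β, (rowChoice β Y X).det = principalMinor A β * X.det := fun β => by
      rw [← det_rowChoice_one, ← Matrix.det_mul, rowChoice_mul, hAX, Matrix.one_mul]
    have hXdet : 0 < X.det :=
      pos_of_mul_pos_right (hdet α ▸ hα.det_pos) (hP.principalMinor_pos hαu).le
    have hiff := isMMatrix_rowChoice_iff_empty hX hY fun β hβ => by
      rw [hdet]; exact mul_pos (hP.principalMinor_pos hβ) hXdet
    refine nonpos_of_isMMatrix_rowChoice hXY hB ?_
      (fun β hβ => (hiff β hβ).2 ((hiff α hαu).1 hα)) i j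
    rw [← hAX, Matrix.det_mul]
    exact mul_ne_zero hP.2.ne hXdet.ne'
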